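/- All graphs are finite and simple. Let $\Gamma$ be a connected bipartite graph with ordered bipartition $(B|B')$, let $G\le\mathrm{Aut}(\Gamma)$, $1\neq N\lhd G$, and let $r\ge 3$ be an integer. The adjacency design $\mathcal D(\Gamma)$ has point set $B$, block set $B'$, and incidence given by adjacency in $\Gamma$. Suppose that both of the following hold. (a) $N$ is transitive on $B$ and has exactly $r$ orbits on $B'$ ($\Gamma$ is $r$-starlike relative to $N$); and $\Gamma$ is locally $(G,4)$-distance transitive, that is, $\Gamma$ has diameter at least $4$ and for each vertex $v$ and each $1\le i\le 4$ the stabiliser $G_v$ is transitive on the (possibly empty) set of vertices at distance $i$ from $v$. (b) $\mathcal D(\Gamma)$ is $G$-pairwise transitive, that is, $G$ acts on $\mathcal D(\Gamma)$ as a group of automorphisms (preserving points, blocks and incidence) and is transitive on each of the following six (possibly empty) sets of ordered pairs: incident and non-incident point-block pairs, collinear and non-collinear pairs of distinct points, intersecting and non-intersecting pairs of distinct blocks; and $\mathcal D(\Gamma)$ is $N$-nicely affine with $r$ parallel classes of blocks, that is, $N$ is transitive on points, has exactly $r$ orbits on blocks, and there is a constant $\mu$ such that distinct blocks are incident with exactly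 $\mu$ common points if they lie in different $N$-orbits and with no common point if they lie in the same $N$-orbit. Suppose moreover that $N$ is regular on $B$ (transitive, and only the identity of $N$ fixes a point of $B$). Then there is a prime $p$ such that $N$ is an elementary abelian $p$-group, and there are an integer $d$, a subgroup $G_0\le\mathrm{GL}(d,p)$ and distinct subspaces $M_1,\dots,M_r$ of $V=V(d,p)=\mathbb F_p^d$ such that, with $T$ the group of translations of $V$ and $\hat G=T.G_0\le\mathrm{AGL}(d,p)$ the group of all maps $v\mapsto Av+w$ with $A\in G_0$, $w\in V$: 1. $\hat G$ has rank $2$ or $3$ on $V$ (a point stabiliser has $2$ or $3$ orbits on $V$); 2. $\mathcal M=\{M_1,\dots,M_r\}$ is a $G_0$-orbit of subspaces on which $G_0$ is $2$-transitive; 3. $V=M_i+M_j$ for all $i\ne j$; 4. for each $i$ the stabiliser $(G_0)_{M_i}$ is transitive on the non-zero elements of $V/M_i$; 5. $\bigcup_{i=1}^r (M_i\setminus\{0\})$ is a $G_0$-orbit; and such that, if $\mathcal D$ is the design whose points are the vectors of $V$, whose blocks are the cosets of $M_1,\dots,M_r$, and whose incidence is membership, there is a bijection from $B\cup B'$ to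 $V\cup\bigcup_i V/M_i$ that is an isomorphism of designs from $\mathcal D(\Gamma)$ to $\mathcal D$ (points to points, blocks to blocks) and an isomorphism of graphs from $\Gamma$ to the incidence graph of $\mathcal D$, and that carries the permutation group $G$ to $\hat G$ and $N$ to $T$, each acting naturally on vectors and cosets. -/

import Mathlib

open scoped Pointwise

namespace Starlike

/-! ### Permutation groups -/

section Permutations

variable {V : Type*}

/-- The permutation group `H` is transitive on the subset `X`
(in particular it leaves `X` invariant). -/
def TransitiveOn (H : Subgroup (Equiv.Perm V)) (X : Set V) : Prop :=
  (∀ h ∈ H, ∀ x ∈ X, h x ∈ X) ∧ ∀ x ∈ X, ∀ y ∈ X, ∃ h ∈ H, h x = y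

/-- The permutation group `H` is regular on `X`: it is transitive on `X` and only the identity
fixes a point of `X`. -/
def RegularOn (H : Subgroup (Equiv.Perm V)) (X : Set V) : Prop :=
  TransitiveOn H X ∧ ∀ h ∈ H, ∀ x ∈ X, h x = x → h = 1

/-- The permutation group `H` is transitive on the (possibly empty) set of ordered pairs
described by the `H`-invariant relation `R`. -/
def TransitiveOnPairs (H : Subgroup (Equiv.Perm V)) (R : V → V → Prop) : Prop :=
  ∀ a b c d, R a b → R c d → ∃ h ∈ H, h a = c ∧ h b = d

/-- The set of orbits of `H` that meet `X` (the `H`-orbits in `X` when `X` is `H`-invariant). -/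
def orbitsIn (H : Subgroup (Equiv.Perm V)) (X : Set V) : Set (Set V) :=
  {O | ∃ x ∈ X, O = MulAction.orbit H x}

/-- `N` is a normal subgroup of `G`, both being subgroups of an ambient group. -/
def IsNormalSubgroupOf {A : Type*} [Group A] (N G : Subgroup A) : Prop :=
  N ≤ G ∧ (N.subgroupOf G).Normal

/-- A group is an elementary abelian `p`-group (`p` a prime). -/
def IsElementaryAbelian (p : ℕ) (A : Type*) [Group A] : Prop :=
  p.Prime ∧ (∀ a b : A, a * b = b * a) ∧ ∀ a : A, a ^ p = 1

/-- The action of `H` on `X` is transitive of rank `k`: a point stabiliser has `k` orbits. -/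
def HasRank (H X : Type*) [Group H] [MulAction H X] (k : ℕ) : Prop :=
  MulAction.IsPretransitive H X ∧
    ∀ x : X, ENat.card (MulAction.orbitRel.Quotient (MulAction.stabilizer H x) X) = k

end Permutations

/-! ### Designs and graphs -/

/-- A design with `V` as the disjoint union of its point set and its block set. -/
structure Design (V : Type*) where
  points : Set V
  blocks : Set V
  isCompl : IsCompl points blocks
  Inc : V → V → Prop
  mem_of_inc : ∀ {x b}, Inc x b → x ∈ points ∧ b ∈ blocks

namespace Design

variable {V : Type*} (D : Design V)

/-- Incident point-block pairs are the pairs in `D.Inc`; these are the non-incident ones. -/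
def NonIncident (x b : V) : Prop := x ∈ D.points ∧ b ∈ D.blocks ∧ ¬ D.Inc x b

/-- Pairs of distinct points that are incident with a common block. -/
def Collinear (x y : V) : Prop :=
  x ∈ D.points ∧ y ∈ D.points ∧ x ≠ y ∧ ∃ b, D.Inc x b ∧ D.Inc y b

/-- Pairs of distinct points that are incident with no common block. -/
def NonCollinear (x y : V) : Prop :=
  x ∈ D.points ∧ y ∈ D.points ∧ x ≠ y ∧ ¬ ∃ b, D.Inc x b ∧ D.Inc y b

/-- Pairs of distinct blocks that are incident with a common point. -/
def Intersecting (b c : V) : Prop :=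
  b ∈ D.blocks ∧ c ∈ D.blocks ∧ b ≠ c ∧ ∃ x, D.Inc x b ∧ D.Inc x c

/-- Pairs of distinct blocks that are incident with no common point. -/
def NonIntersecting (b c : V) : Prop :=
  b ∈ D.blocks ∧ c ∈ D.blocks ∧ b ≠ c ∧ ¬ ∃ x, D.Inc x b ∧ D.Inc x c

/-- `σ` is an automorphism of the design: a permutation of points and blocks that preserves points,
blocks, and incidence. -/
def IsAut (σ : Equiv.Perm V) : Prop :=
  (∀ x, σ x ∈ D.points ↔ x ∈ D.points) ∧ (∀ b, σ b ∈ D.blocks ↔ b ∈ D.blocks) ∧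
    ∀ x b, D.Inc (σ x) (σ b) ↔ D.Inc x b

/-- The design is `G`-pairwise transitive. -/
def PairwiseTransitive (G : Subgroup (Equiv.Perm V)) : Prop :=
  (∀ σ ∈ G, D.IsAut σ) ∧
    TransitiveOnPairs G D.Inc ∧ TransitiveOnPairs G D.NonIncident ∧
    TransitiveOnPairs G D.Collinear ∧ TransitiveOnPairs G D.NonCollinear ∧
    TransitiveOnPairs G D.Intersecting ∧ TransitiveOnPairs G D.NonIntersecting

/-- The design is `N`-nicely affine. -/
def NicelyAffine (N : Subgroup (Equiv.Perm V)) : Prop :=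
  (∀ σ ∈ N, D.IsAut σ) ∧ TransitiveOn N D.points ∧
    ∃ μ : ℕ, ∀ b ∈ D.blocks, ∀ c ∈ D.blocks, b ≠ c →
      (c ∉ MulAction.orbit N b → {x | D.Inc x b ∧ D.Inc x c}.encard = μ) ∧
      (c ∈ MulAction.orbit N b → {x | D.Inc x b ∧ D.Inc x c} = ∅)

/-- The incidence graph of a design. -/
def incidenceGraph : SimpleGraph V where
  Adj x y := D.Inc x y ∨ D.Inc y x
  symm := ⟨fun _ _ h => h.symm⟩
  loopless := ⟨fun _ h => by
    have h' := D.mem_of_inc (h.elim id id)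
    exact Set.disjoint_left.1 D.isCompl.disjoint h'.1 h'.2⟩

/-- `Φ` is an isomorphism from the design `D` to the design `E`. -/
def IsIso {W : Type*} (E : Design W) (Φ : V ≃ W) : Prop :=
  (∀ x, Φ x ∈ E.points ↔ x ∈ D.points) ∧ (∀ b, Φ b ∈ E.blocks ↔ b ∈ D.blocks) ∧
    ∀ x b, E.Inc (Φ x) (Φ b) ↔ D.Inc x b

end Design

section Graphs

variable {V : Type*}

/-- `(B | B')` is an ordered bipartition of the graph `Γ`. -/
structure IsOrderedBipartition (Γ : SimpleGraph V) (B B' : Set V) : Prop where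
  isCompl : IsCompl B B'
  isBipartiteWith : Γ.IsBipartiteWith B B'

/-- The adjacency design of a bipartite graph with ordered bipartition `(B | B')`. -/
def adjacencyDesign (Γ : SimpleGraph V) (B B' : Set V) (h : IsOrderedBipartition Γ B B') :
    Design V where
  points := B
  blocks := B'
  isCompl := h.isCompl
  Inc x b := x ∈ B ∧ b ∈ B' ∧ Γ.Adj x b
  mem_of_inc hx := ⟨hx.1, hx.2.1⟩

/-- The permutation group `H` consists of automorphisms of the graph `Γ`. -/
def ActsOnGraph (Γ : SimpleGraph V) (H : Subgroup (Equiv.Perm V)) : Prop :=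
  ∀ σ ∈ H, ∀ x y, Γ.Adj (σ x) (σ y) ↔ Γ.Adj x y

/-- `Γ`, with ordered bipartition `(B | B')`, is `r`-starlike relative to `N`. -/
def IsStarlike (Γ : SimpleGraph V) (B B' : Set V) (N : Subgroup (Equiv.Perm V)) (r : ℕ) : Prop :=
  Γ.Connected ∧ IsOrderedBipartition Γ B B' ∧ ActsOnGraph Γ N ∧ 2 ≤ r ∧ TransitiveOn N B ∧
    (orbitsIn N B').encard = r

/-- `Γ` is locally `(G, s)`-distance transitive: its diameter is at least `s` and, for all vertices
`v` and all `1 ≤ i ≤ s`, the stabiliser of `v` in `G` is transitive on the (possibly empty) set of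
vertices at distance `i` from `v`. -/
def LocallyDistanceTransitive (Γ : SimpleGraph V) (G : Subgroup (Equiv.Perm V)) (s : ℕ) : Prop :=
  (s : ℕ∞) ≤ Γ.ediam ∧ ActsOnGraph Γ G ∧
    ∀ v, ∀ i : ℕ, 1 ≤ i → i ≤ s → ∀ x y, Γ.edist v x = i → Γ.edist v y = i →
      ∃ g ∈ G, g v = v ∧ g x = y

end Graphs

/-! ### The affine construction -/

section Affine

variable {p d : ℕ}

/-- The group `T . G₀` of affine transformations of `V(d, p)`, `T` the group of all translations:
the affine bijections whose linear part lies in `G₀`. -/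
def affineGroup (G₀ : Subgroup ((Fin d → ZMod p) ≃ₗ[ZMod p] (Fin d → ZMod p))) :
    Subgroup ((Fin d → ZMod p) ≃ᵃ[ZMod p] (Fin d → ZMod p)) :=
  G₀.comap AffineEquiv.linearHom

/-- The group of all translations of `V(d, p)`, as a subgroup of `T . G₀`. -/
def translations (G₀ : Subgroup ((Fin d → ZMod p) ≃ₗ[ZMod p] (Fin d → ZMod p))) :
    Subgroup (affineGroup G₀) :=
  (AffineEquiv.constVAddHom (ZMod p) (Fin d → ZMod p)).range.subgroupOf (affineGroup G₀)

/-- The natural action on vectors. -/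
instance vectorAction (G₀ : Subgroup ((Fin d → ZMod p) ≃ₗ[ZMod p] (Fin d → ZMod p))) :
    MulAction (affineGroup G₀) (Fin d → ZMod p) where
  smul f v := f.1 v
  one_smul _ := rfl
  mul_smul _ _ _ := rfl

end Affine

/-- The input of the affine construction. -/
structure AffineData (p d r : ℕ) where
  prime : p.Prime
  three_le : 3 ≤ r
  /-- The linear group `G₀ ≤ GL(d, p)`. -/
  G₀ : Subgroup ((Fin d → ZMod p) ≃ₗ[ZMod p] (Fin d → ZMod p))
  /-- The `r` distinct subspaces `M₁, …, Mᵣ`. -/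
  M : Fin r → Submodule (ZMod p) (Fin d → ZMod p)
  M_injective : Function.Injective M
  /-- (a) The affine group `G = T . G₀` has rank `2` or `3` on vectors. -/
  rank : HasRank (affineGroup G₀) (Fin d → ZMod p) 2 ∨ HasRank (affineGroup G₀) (Fin d → ZMod p) 3
  /-- (b) `{M₁, …, Mᵣ}` is an orbit of `G₀` … -/
  isOrbit : ∃ U : Submodule (ZMod p) (Fin d → ZMod p),
    Set.range M = {U' | ∃ g ∈ G₀, U' = U.map g.toLinearMap}
  /-- … on which `G₀` is `2`-transitive. -/
  twoTransitive : ∀ i j k l, i ≠ j → k ≠ l →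
    ∃ g ∈ G₀, (M i).map g.toLinearMap = M k ∧ (M j).map g.toLinearMap = M l
  /-- (c) Any two distinct members of the orbit span the space. -/
  sup_eq_top : ∀ i j, i ≠ j → M i ⊔ M j = ⊤
  /-- (d) The stabiliser of `Mᵢ` in `G₀` is transitive on the non-trivial elements of the quotient
  space by `Mᵢ`. -/
  quotientTransitive : ∀ i, ∀ u v, u ∉ M i → v ∉ M i →
    ∃ g ∈ G₀, (M i).map g.toLinearMap = M i ∧ (M i).mkQ (g u) = (M i).mkQ v
  /-- (e) The non-zero vectors in the union of the subspaces form an orbit of `G₀`. -/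
  unionOrbit : ∃ u, {v | v ≠ 0 ∧ ∃ i, v ∈ M i} = {v | ∃ g ∈ G₀, v = g u}

namespace AffineData

variable {p d r : ℕ} (C : AffineData p d r)

/-- The blocks: the cosets of the subspaces `Mᵢ`. -/
def Block : Type :=
  {S : Set (Fin d → ZMod p) // ∃ (i : Fin r) (v : Fin d → ZMod p), S = v +ᵥ (C.M i : Set (Fin d → ZMod p))}

/-- The constructed design, with vectors as points, cosets as blocks, and inclusion as incidence. -/
def design : Design ((Fin d → ZMod p) ⊕ C.Block) where
  points := Set.range Sum.inl
  blocks := Set.range Sum.inr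
  isCompl := Set.isCompl_range_inl_range_inr
  Inc x b := ∃ (v : Fin d → ZMod p) (S : C.Block), x = Sum.inl v ∧ b = Sum.inr S ∧ v ∈ S.1
  mem_of_inc := by
    rintro _ _ ⟨v, S, rfl, rfl, -⟩
    exact ⟨⟨v, rfl⟩, ⟨S, rfl⟩⟩

theorem image_block (f : affineGroup C.G₀) (S : C.Block) :
    ∃ (i : Fin r) (v : Fin d → ZMod p), (fun x => f.1 x) '' S.1 = v +ᵥ (C.M i : Set (Fin d → ZMod p)) := by
  obtain ⟨f, hf⟩ := f
  obtain ⟨_, i, v, rfl⟩ := S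
  obtain ⟨U, hU⟩ := C.isOrbit
  have hi : C.M i ∈ Set.range C.M := ⟨i, rfl⟩
  rw [hU] at hi
  obtain ⟨g, hg, hgi⟩ := hi
  have hj : (C.M i).map f.linear.toLinearMap ∈ Set.range C.M := by
    rw [hU]
    refine ⟨f.linear * g, C.G₀.mul_mem hf hg, ?_⟩
    rw [hgi, ← Submodule.map_comp]
    rfl
  obtain ⟨j, hj⟩ := hj
  refine ⟨j, f v, ?_⟩
  rw [hj]
  ext y
  simp only [Set.mem_image, Set.mem_vadd_set, vadd_eq_add, SetLike.mem_coe, Submodule.mem_map]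
  have key : ∀ w, f (v + w) = f v + f.linear w := fun w => by
    have := f.map_vadd v w
    simpa [add_comm] using this
  constructor
  · rintro ⟨_, ⟨w, hw, rfl⟩, rfl⟩
    exact ⟨f.linear w, ⟨w, hw, rfl⟩, (key w).symm⟩
  · rintro ⟨_, ⟨w, hw, rfl⟩, rfl⟩
    exact ⟨v + w, ⟨w, hw, rfl⟩, key w⟩

/-- The natural action of `T . G₀` on the blocks. -/
instance blockAction : MulAction (affineGroup C.G₀) C.Block where
  smul f S := ⟨(fun x => f.1 x) '' S.1, C.image_block f S⟩
  one_smul S := Subtype.ext (Set.image_id S.1)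
  mul_smul f g S := Subtype.ext (Set.image_comp (fun x => f.1 x) (fun x => g.1 x) S.1)

/-- The group `G = T . G₀`, acting on the points and blocks of the constructed design. -/
def group : Subgroup (Equiv.Perm ((Fin d → ZMod p) ⊕ C.Block)) :=
  (MulAction.toPermHom (affineGroup C.G₀) ((Fin d → ZMod p) ⊕ C.Block)).range

/-- The group of translations, acting on the points and blocks of the constructed design. -/
def translationGroup : Subgroup (Equiv.Perm ((Fin d → ZMod p) ⊕ C.Block)) :=
  (translations C.G₀).map (MulAction.toPermHom (affineGroup C.G₀) ((Fin d → ZMod p) ⊕ C.Block))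

end AffineData

end Starlike

/-! Fix a point `x₀`. Since `N` is regular on points, `n ↦ n x₀` identifies `N` with the point set.
Blocks in one `N`-orbit are disjoint, so each of the `r` orbits has exactly one block through `x₀`.
For such a block `b` with stabiliser `N_b`, the points on `n b` form the left coset `n N_b`
(`inc_apply_iff`). Blocks from different orbits always meet in `μ` points, which gives `N = N_b N_c`
for distinct blocks `b`, `c` through `x₀` (`exists_mul_eq`).

`G` acts on `N` by conjugation, and pairwise transitivity becomes fusion. Collinear pairs fuse the
nontrivial elements of the union of the `N_b`, non-collinear pairs fuse the remaining nontrivial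
elements, and non-intersecting pairs fuse the nontrivial cosets of each `N_b`. The first and last
facts, with `N = N_b N_c`, force `N` to be elementary abelian: it is a `p`-group, and a nontrivial
central element either lies in `N_b`, and then its conjugates generate `N`, or has conjugates in
every nontrivial coset of `N_b`, with `N_b` abelian.

Now `N` is a vector space `V`, the `N_b` are the subspaces `M_i`, and `G₀` is the image of `G` under
conjugation. If `g x₀ = n x₀`, then `g` acts on `V` as its conjugation map followed by translation
by `n` (`permCongr_eq_toPerm`), so `G` becomes `T.G₀` and `N` becomes `T`. -/

open scoped commutatorElement

namespace Starlike

/-! ### Fusion forces a factorised group to be elementary abelian -/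

section GroupTheory

variable {N : Type*} [Group N]

/-- A finite group that is the product of two `p`-subgroups is a `p`-group. -/
theorem isPGroup_of_mul_eq [Finite N] {p : ℕ} [Fact p.Prime] {H K : Subgroup N}
    (hH : IsPGroup p H) (hK : IsPGroup p K) (hHK : ∀ n : N, ∃ k ∈ K, ∃ h ∈ H, n = k * h) :
    IsPGroup p N := by
  -- As `N = K H`, `K` is transitive on `N ⧸ H`, so the index of `H` divides `|K|`.
  have : MulAction.IsPretransitive K (N ⧸ H) := by
    refine (MulAction.isPretransitive_iff_base ((1 : N) : N ⧸ H)).2 fun y => ?_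
    induction y using QuotientGroup.induction_on with
    | H n =>
      obtain ⟨k, hk, h, hh, rfl⟩ := hHK n
      refine ⟨⟨k, hk⟩, ?_⟩
      change ((k * 1 : N) : N ⧸ H) = _
      rw [QuotientGroup.eq]
      simpa using hh
  obtain ⟨a, ha⟩ := IsPGroup.iff_card.1 hH
  obtain ⟨b, hb⟩ := IsPGroup.iff_card.1 hK
  have hi := MulAction.index_stabilizer_of_transitive K ((1 : N) : N ⧸ H)
  have hd : H.index ∣ p ^ b := by
    rw [← hb, Subgroup.index, ← hi]
    exact Subgroup.index_dvd_card _
  obtain ⟨c, -, hc⟩ := (Nat.dvd_prime_pow Fact.out).1 hd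
  refine IsPGroup.iff_card.2 ⟨a + c, ?_⟩
  rw [← H.card_mul_index, ha, hc, pow_add]

/-- Let `N = K H` be a finite group, and `A` a group of automorphisms of `N` that fuses the
nontrivial elements of `H` and `K`, and for which the nontrivial left cosets of `H` are
fused as well. Then `N` is an elementary abelian group. -/
theorem exists_isElementaryAbelian [Finite N] [Nontrivial N] {H K : Subgroup N}
    (A : Subgroup (MulAut N)) (hHK : ∀ n : N, ∃ k ∈ K, ∃ h ∈ H, n = k * h)
    (hU : ∀ u v : N, (u ∈ H ∨ u ∈ K) → (v ∈ H ∨ v ∈ K) → u ≠ 1 → v ≠ 1 → ∃ a ∈ A, a u = v)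
    (hq : ∀ u v : N, u ∉ H → v ∉ H → ∃ a ∈ A, v⁻¹ * a u ∈ H) :
    ∃ p, IsElementaryAbelian p N := by
  obtain ⟨u₀, hu₀, hu₀1⟩ : ∃ u : N, (u ∈ H ∨ u ∈ K) ∧ u ≠ 1 := by
    obtain ⟨n, hn⟩ := exists_ne (1 : N)
    obtain ⟨k, hk, h, hh, rfl⟩ := hHK n
    by_cases h1 : h = 1
    · exact ⟨k, .inr hk, by simpa [h1] using hn⟩
    · exact ⟨h, .inl hh, h1⟩
  -- A suitable power of `u₀` has order `p` and stays in `H` or `K`, so fusion gives every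
  -- nontrivial element of `H ∪ K` order `p`.
  set p := (orderOf u₀).minFac
  have hp : p.Prime := Nat.minFac_prime (by simpa using hu₀1)
  have : Fact p.Prime := ⟨hp⟩
  have hpow : ∀ u : N, (u ∈ H ∨ u ∈ K) → u ^ p = 1 := by
    intro u hu
    by_cases hu1 : u = 1
    · simp [hu1]
    have ho : orderOf (u₀ ^ (orderOf u₀ / p)) = p :=
      orderOf_pow_orderOf_div (orderOf_pos u₀).ne' (Nat.minFac_dvd _)
    obtain ⟨a, -, rfl⟩ := hU (u₀ ^ (orderOf u₀ / p)) u
      (hu₀.imp (fun h => pow_mem h _) (fun h => pow_mem h _)) hu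
      (fun h => hp.one_lt.ne' (by rw [← ho, h, orderOf_one])) hu1
    rw [← map_pow, show (u₀ ^ (orderOf u₀ / p)) ^ p = 1 from by
      exact orderOf_dvd_iff_pow_eq_one.1 ho.dvd, map_one]
  have hPH : IsPGroup p H := fun g => ⟨1, Subtype.ext (by simpa using hpow g (.inl g.2))⟩
  have hPK : IsPGroup p K := fun g => ⟨1, Subtype.ext (by simpa using hpow g (.inr g.2))⟩
  have hP : IsPGroup p N := isPGroup_of_mul_eq hPH hPK hHK
  -- A characteristic subgroup meeting `H ∪ K` nontrivially absorbs all of it by fusion, and `H ∪ K`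
  -- generates `N`.
  have htop : ∀ X : Subgroup N, X.Characteristic → ∀ u ∈ X, (u ∈ H ∨ u ∈ K) → u ≠ 1 → X = ⊤ := by
    intro X hX u huX hu hu1
    have hmem : ∀ v, (v ∈ H ∨ v ∈ K) → v ∈ X := by
      intro v hv
      by_cases hv1 : v = 1
      · simp [hv1, one_mem]
      obtain ⟨a, -, rfl⟩ := hU u v hu hv hu1 hv1
      have := Subgroup.characteristic_iff_map_eq.1 hX a
      rw [← this]
      exact Subgroup.mem_map_of_mem _ huX
    refine (Subgroup.eq_top_iff' X).2 fun n => ?_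
    obtain ⟨k, hk, h, hh, rfl⟩ := hHK n
    exact X.mul_mem (hmem k (.inr hk)) (hmem h (.inl hh))
  have hcomm : Subgroup.center N = ⊤ := by
    have hZ := hP.center_nontrivial
    obtain ⟨⟨z, hz⟩, hz1⟩ := exists_ne (1 : Subgroup.center N)
    have hz1 : z ≠ 1 := fun h => hz1 (Subtype.ext h)
    by_cases hzH : z ∈ H
    · exact htop _ inferInstance z hz (.inl hzH) hz1
    have hnil := hP.isNilpotent
    have hlt := Group.IsSolvable.commutator_lt_top_of_nontrivial N
    -- A nontrivial commutator inside `H` would make the commutator subgroup all of `N`, impossible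
    -- in a nontrivial nilpotent group.
    have hHcomm : ∀ a ∈ H, ∀ b ∈ H, a * b = b * a := by
      intro a ha b hb
      by_contra hab
      have h1 : ⁅a, b⁆ ≠ 1 := fun h => hab (commutatorElement_eq_one_iff_mul_comm.1 h)
      refine hlt.ne (htop _ inferInstance ⁅a, b⁆ ?_ (.inl ?_) h1)
      · exact Subgroup.commutator_mem_commutator (Subgroup.mem_top _) (Subgroup.mem_top _)
      · exact H.mul_mem (H.mul_mem (H.mul_mem ha hb) (H.inv_mem ha)) (H.inv_mem hb)
    -- The images of the central element `z ∉ H` meet every nontrivial coset of `H`, so `N = Z(N) H`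
    -- with `H` abelian.
    have hdec : ∀ n : N, ∃ y ∈ Subgroup.center N, ∃ h ∈ H, n = y * h := by
      intro n
      by_cases hn : n ∈ H
      · exact ⟨1, one_mem _, n, hn, (one_mul _).symm⟩
      obtain ⟨a, -, ha⟩ := hq z n hzH hn
      refine ⟨a z, ?_, (n⁻¹ * a z)⁻¹, H.inv_mem ha, by group⟩
      have := Subgroup.characteristic_iff_map_eq.1 (inferInstance : (Subgroup.center N).Characteristic) a
      rw [← this]
      exact Subgroup.mem_map_of_mem _ hz
    refine (Subgroup.eq_top_iff' _).2 fun n => Subgroup.mem_center_iff.2 fun g => ?_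
    obtain ⟨y, hy, h, hh, rfl⟩ := hdec n
    obtain ⟨y', hy', h', hh', rfl⟩ := hdec g
    have e := Subgroup.mem_center_iff.1 hy
    have e' := Subgroup.mem_center_iff.1 hy'
    calc y' * h' * (y * h) = y' * ((h' * y) * h) := by group
      _ = y' * (y * (h' * h)) := by rw [e h']; group
      _ = y' * (y * (h * h')) := by rw [hHcomm h' hh' h hh]
      _ = (y * h * h') * y' := by rw [← e']; group
      _ = y * h * (y' * h') := by rw [mul_assoc, e' h']
  have hc : ∀ a b : N, a * b = b * a := fun a b =>
    Subgroup.mem_center_iff.1 (by rw [hcomm]; trivial) a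
  refine ⟨p, hp, hc, fun n => ?_⟩
  obtain ⟨k, hk, h, hh, rfl⟩ := hHK n
  rw [Commute.mul_pow (hc k h), hpow k (.inr hk), hpow h (.inl hh), one_mul]

end GroupTheory

/-! ### Elementary abelian groups as vector spaces -/

section Linear

variable {p : ℕ} {W N : Type*} [AddCommGroup W] [Module (ZMod p) W] [Group N]

/-- The linear action of the automorphisms of `N` on a vector space identified with `N`. -/
def linearOfMulAut (φ : Additive N ≃+ W) : MulAut N →* (W ≃ₗ[ZMod p] W) where
  toFun a := ((φ.symm.trans (MulEquiv.toAdditive a)).trans φ).toLinearEquiv (fun c x => ZMod.map_smul _ c x)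
  map_one' := by ext x; simp
  map_mul' a b := by ext x; simp

theorem linearOfMulAut_apply (φ : Additive N ≃+ W) (a : MulAut N) (n : N) :
    linearOfMulAut (p := p) φ a (φ (Additive.ofMul n)) = φ (Additive.ofMul (a n)) := by
  simp [linearOfMulAut]

/-- An elementary abelian `p`-group is the additive group of some `V(d, p)`. -/
theorem exists_addEquiv_fin_zmod [Finite N] (h : IsElementaryAbelian p N) :
    ∃ d : ℕ, Nonempty (Additive N ≃+ (Fin d → ZMod p)) := by
  obtain ⟨hp, hc, hpow⟩ := h
  have : Fact p.Prime := ⟨hp⟩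
  -- Extending the existing additive group keeps its addition, so the resulting equivalence is one
  -- for the original structure.
  let _ : AddCommGroup (Additive N) :=
    { (inferInstance : AddGroup (Additive N)) with add_comm := fun a b => hc a.toMul b.toMul }
  let _ : Module (ZMod p) (Additive N) := AddCommGroup.zmodModule (n := p) fun x => hpow x.toMul
  have : Module.Finite (ZMod p) (Additive N) := Module.Finite.of_finite
  exact ⟨_, ⟨(Module.finBasis (ZMod p) (Additive N)).equivFun.toAddEquiv⟩⟩

end Linear

/-! ### Rank of the affine group -/

section Rank

variable {p d : ℕ}

/-- The affine map with linear part `g` that sends `0` to `w`. -/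
def affineOfLinear (g : (Fin d → ZMod p) ≃ₗ[ZMod p] (Fin d → ZMod p)) (w : Fin d → ZMod p) :
    (Fin d → ZMod p) ≃ᵃ[ZMod p] (Fin d → ZMod p) :=
  g.toAffineEquiv.trans (AffineEquiv.constVAdd (ZMod p) _ w)

@[simp]
theorem affineOfLinear_apply (g : (Fin d → ZMod p) ≃ₗ[ZMod p] (Fin d → ZMod p))
    (w v : Fin d → ZMod p) : affineOfLinear g w v = g v + w :=
  add_comm _ _

theorem eq_affineOfLinear (f : (Fin d → ZMod p) ≃ᵃ[ZMod p] (Fin d → ZMod p)) :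
    f = affineOfLinear f.linear (f 0) := by
  ext1 v
  simpa using f.map_vadd 0 v

/-- The fibres of a complete invariant are the orbits, so `f` descends to a bijection. -/
theorem encard_orbits_eq_of_invariant {H X : Type*} [Group H] [MulAction H X] {k : ℕ} (f : X → Fin k)
    (hf : Function.Surjective f) (h : ∀ x y, f x = f y ↔ ∃ g : H, g • x = y) :
    ENat.card (MulAction.orbitRel.Quotient H X) = k := by
  have hinv : ∀ x y : X, MulAction.orbitRel H X x y → f x = f y := by
    rintro x y hxy
    obtain ⟨g, hg⟩ := MulAction.orbitRel_apply.1 hxy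
    exact ((h y x).2 ⟨g, hg⟩).symm
  have hb : Function.Bijective (Quotient.lift (s := MulAction.orbitRel H X) f hinv) := by
    refine ⟨?_, fun i => ?_⟩
    · rintro ⟨x⟩ ⟨y⟩ hxy
      obtain ⟨g, hg⟩ := (h y x).1 (Eq.symm hxy)
      exact Quotient.sound (s := MulAction.orbitRel H X) (MulAction.orbitRel_apply.2 ⟨g, hg⟩)
    · obtain ⟨x, rfl⟩ := hf i
      exact ⟨Quotient.mk _ x, rfl⟩
  have := ENat.card_congr (Equiv.ofBijective _ hb)
  rw [show ENat.card (MulAction.orbitRel.Quotient H X) = _ from this]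
  simp

/-- The affine group has rank `2` or `3` when its linear part has at most two orbits on
nonzero vectors. -/
theorem hasRank_affineGroup (G₀ : Subgroup ((Fin d → ZMod p) ≃ₗ[ZMod p] (Fin d → ZMod p)))
    (U : Set (Fin d → ZMod p)) (hU0 : 0 ∉ U) (hUn : U.Nonempty)
    (hUi : ∀ g ∈ G₀, ∀ u ∈ U, g u ∈ U)
    (hUt : ∀ u ∈ U, ∀ v ∈ U, ∃ g ∈ G₀, g u = v)
    (hUc : ∀ u v, u ≠ 0 → v ≠ 0 → u ∉ U → v ∉ U → ∃ g ∈ G₀, g u = v) :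
    HasRank (affineGroup G₀) (Fin d → ZMod p) 2 ∨ HasRank (affineGroup G₀) (Fin d → ZMod p) 3 := by
  classical
  have hpre : MulAction.IsPretransitive (affineGroup G₀) (Fin d → ZMod p) := by
    refine ⟨fun x y => ⟨⟨AffineEquiv.constVAdd (ZMod p) _ (y - x), ?_⟩, ?_⟩⟩
    · change AffineEquiv.linear _ ∈ G₀
      rw [AffineEquiv.linear_constVAdd]
      exact one_mem _
    · change (y - x) +ᵥ x = y
      simp
  have hUi' : ∀ g ∈ G₀, ∀ u, g u ∈ U ↔ u ∈ U := fun g hg u =>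
    ⟨fun h => by simpa using hUi g⁻¹ (inv_mem hg) _ h, hUi g hg u⟩
  -- The stabiliser of `x` consists of the maps `v ↦ g (v - x) + x`, so its orbits are read off from
  -- the differences with `x`.
  have horb : ∀ x y z, (∃ g : MulAction.stabilizer (affineGroup G₀) x, g • y = z) ↔
      ∃ g ∈ G₀, g (y - x) = z - x := by
    intro x y z
    constructor
    · rintro ⟨⟨⟨f, hf⟩, hx⟩, hy⟩
      have hx : f x = x := hx
      have hy : f y = z := hy
      refine ⟨f.linear, hf, ?_⟩
      have := f.toAffineMap.linearMap_vsub y x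
      simpa [hx, hy] using this
    · rintro ⟨g, hg, hgy⟩
      refine ⟨⟨⟨affineOfLinear g (x - g x), hg⟩, ?_⟩, ?_⟩
      · change affineOfLinear g (x - g x) x = x
        simp
      · change affineOfLinear g (x - g x) y = z
        rw [map_sub] at hgy
        rw [affineOfLinear_apply, add_sub_left_comm, hgy]
        abel
  -- The rank is 3 or 2 according to whether or not some nonzero vector lies outside `U`.
  by_cases hex : ∃ w, w ≠ 0 ∧ w ∉ U
  · right
    refine ⟨hpre, fun x => ?_⟩
    refine encard_orbits_eq_of_invariant
      (fun y => if y - x = 0 then (0 : Fin 3) else if y - x ∈ U then 1 else 2) ?_ ?_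
    · obtain ⟨u, hu⟩ := hUn
      obtain ⟨w, hw, hwU⟩ := hex
      have hu0 : u ≠ 0 := fun h => hU0 (h ▸ hu)
      intro i
      fin_cases i
      · exact ⟨x, by simp⟩
      · exact ⟨u + x, by simp [hu, hu0]⟩
      · exact ⟨w + x, by simp [hw, hwU]⟩
    · intro y z
      rw [horb]
      generalize y - x = u, z - x = v
      constructor
      · intro h
        by_cases hu : u = 0
        · by_cases hv : v = 0
          · exact ⟨1, one_mem _, by simp [hu, hv]⟩
          · by_cases hvU : v ∈ U <;> simp [hu, hv, hvU] at h
        · by_cases hv : v = 0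
          · by_cases huU : u ∈ U <;> simp [hu, hv, huU] at h
          · by_cases huU : u ∈ U <;> by_cases hvU : v ∈ U <;> simp [hu, hv, huU, hvU] at h
            · exact hUt u huU v hvU
            · exact hUc u v hu hv huU hvU
      · rintro ⟨g, hg, rfl⟩
        simp [hUi' g hg]
  · left
    push Not at hex
    refine ⟨hpre, fun x => ?_⟩
    refine encard_orbits_eq_of_invariant (fun y => if y - x = 0 then (0 : Fin 2) else 1) ?_ ?_
    · obtain ⟨u, hu⟩ := hUn
      have hu0 : u ≠ 0 := fun h => hU0 (h ▸ hu)
      intro i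
      fin_cases i
      · exact ⟨x, by simp⟩
      · exact ⟨u + x, by simp [hu0]⟩
    · intro y z
      rw [horb]
      generalize y - x = u, z - x = v
      constructor
      · intro h
        by_cases hu : u = 0
        · by_cases hv : v = 0
          · exact ⟨1, one_mem _, by simp [hu, hv]⟩
          · simp [hu, hv] at h
        · by_cases hv : v = 0
          · simp [hu, hv] at h
          · exact hUt u (hex u hu) v (hex v hv)
      · rintro ⟨g, hg, rfl⟩
        simp

end Rank

end Starlike

/-! ### Points as group elements, blocks as cosets -/

namespace Starlike

/-- A `G`-pairwise transitive and `N`-nicely affine design with `N` normalised by `G` and regular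
on points, together with a base point. -/
structure RegularNicelyAffine {V : Type*} (D : Design V) (G N : Subgroup (Equiv.Perm V)) (r : ℕ)
    (x₀ : V) : Prop where
  le : N ≤ G
  le_normalizer : G ≤ Subgroup.normalizer (N : Set (Equiv.Perm V))
  three_le : 3 ≤ r
  base_mem : x₀ ∈ D.points
  regular : RegularOn N D.points
  pairwise : D.PairwiseTransitive G
  affine : D.NicelyAffine N
  orbits : (orbitsIn N D.blocks).encard = r
  exists_inc : ∀ b ∈ D.blocks, ∃ x, D.Inc x b
  exists_nonIncident : ∃ x b, D.NonIncident x b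

/-- The stabiliser of a block in `N`. -/
def blockGroup {V : Type*} (N : Subgroup (Equiv.Perm V)) (b : V) : Subgroup N :=
  MulAction.stabilizer N b

theorem mem_blockGroup {V : Type*} {N : Subgroup (Equiv.Perm V)} {b : V} {n : N} :
    n ∈ blockGroup N b ↔ n.1 b = b := Iff.rfl

namespace RegularNicelyAffine

variable {V : Type*} {D : Design V} {G N : Subgroup (Equiv.Perm V)} {r : ℕ} {x₀ : V}
  (h : RegularNicelyAffine D G N r x₀)

include h

theorem inc_iff {g : Equiv.Perm V} (hg : g ∈ G) (x b : V) : D.Inc (g x) (g b) ↔ D.Inc x b :=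
  (h.pairwise.1 g hg).2.2 x b

theorem inc_iff' (n : N) (x b : V) : D.Inc (n.1 x) (n.1 b) ↔ D.Inc x b :=
  h.inc_iff (h.le n.2) x b

theorem points_iff {g : Equiv.Perm V} (hg : g ∈ G) (x : V) : g x ∈ D.points ↔ x ∈ D.points :=
  (h.pairwise.1 g hg).1 x

theorem blocks_iff {g : Equiv.Perm V} (hg : g ∈ G) (x : V) : g x ∈ D.blocks ↔ x ∈ D.blocks :=
  (h.pairwise.1 g hg).2.1 x

theorem exists_eq {x : V} (hx : x ∈ D.points) : ∃ n : N, n.1 x₀ = x := by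
  obtain ⟨n, hn, e⟩ := h.regular.1.2 x₀ h.base_mem x hx
  exact ⟨⟨n, hn⟩, e⟩

theorem mem_points (n : N) : n.1 x₀ ∈ D.points := (h.points_iff (h.le n.2) _).2 h.base_mem

theorem eq_of_apply_eq {m n : N} (e : m.1 x₀ = n.1 x₀) : m = n := by
  have := h.regular.2 (n⁻¹ * m : N).1 (n⁻¹ * m : N).2 x₀ h.base_mem
    (by simp [e])
  exact (inv_mul_eq_one.1 (Subtype.ext this)).symm

/-- Distinct blocks in one `N`-orbit are disjoint. -/
theorem eq_of_inc_of_inc {x b : V} {n : N} (hb : D.Inc x b) (hc : D.Inc x (n.1 b)) : n.1 b = b := by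
  by_contra hne
  obtain ⟨μ, hμ⟩ := h.affine.2.2
  have := (hμ b (D.mem_of_inc hb).2 _ (D.mem_of_inc hc).2 (Ne.symm hne)).2 ⟨n, rfl⟩
  exact (this ▸ (show x ∈ {x | D.Inc x b ∧ D.Inc x (n.1 b)} from ⟨hb, hc⟩) : x ∈ (∅ : Set V))

/-- Translating by `n⁻¹` reduces to `n = 1`. If `k x₀` is on `b`, it is on both `b` and `k b`, and
parallelism forces `k b = b`. -/
theorem inc_apply_iff {b : V} (hb : D.Inc x₀ b) (m n : N) :
    D.Inc (m.1 x₀) (n.1 b) ↔ n⁻¹ * m ∈ blockGroup N b := by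
  have e : D.Inc (m.1 x₀) (n.1 b) ↔ D.Inc ((n⁻¹ * m : N).1 x₀) b := by
    rw [← h.inc_iff' n ((n⁻¹ * m : N).1 x₀) b]
    simp
  rw [e, mem_blockGroup]
  generalize n⁻¹ * m = k
  constructor
  · intro hk
    exact h.eq_of_inc_of_inc hk ((h.inc_iff' k _ _).2 hb)
  · intro hk
    have := (h.inc_iff' k x₀ b).2 hb
    rwa [hk] at this

theorem exists_inc_apply {b : V} (hb : b ∈ D.blocks) : ∃ n : N, D.Inc x₀ (n.1 b) := by
  obtain ⟨x, hx⟩ := h.exists_inc b hb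
  obtain ⟨n, rfl⟩ := h.exists_eq (D.mem_of_inc hx).1
  refine ⟨n⁻¹, ?_⟩
  rw [← h.inc_iff' n]
  simpa using hx

/-- Flag-transitivity carries the one known non-incident pair to any block. -/
theorem exists_not_inc {b : V} (hb : b ∈ D.blocks) : ∃ x ∈ D.points, ¬ D.Inc x b := by
  obtain ⟨y, c, hy, hc, hyc⟩ := h.exists_nonIncident
  obtain ⟨x, hx⟩ := h.exists_inc b hb
  obtain ⟨z, hz⟩ := h.exists_inc c hc
  obtain ⟨g, hg, -, rfl⟩ := h.pairwise.2.1 z c x b hz hx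
  exact ⟨g y, (h.points_iff hg y).2 hy, fun hh => hyc ((h.inc_iff hg _ _).1 hh)⟩

/-- Both `c` and `n c` lie outside the orbit of `b`, so `b` meets `n c` in as many points as it
meets `c`, a nonzero number because of `x₀`. A common point `k x₀` gives `k ∈ N_b ∩ n N_c`. -/
theorem exists_mul_eq {b c : V} (hb : D.Inc x₀ b) (hc : D.Inc x₀ c) (hbc : b ≠ c) (n : N) :
    ∃ k ∈ blockGroup N b, ∃ l ∈ blockGroup N c, n = k * l := by
  obtain ⟨μ, hμ⟩ := h.affine.2.2
  have horb : ∀ n : N, n.1 c ∉ MulAction.orbit N b := by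
    rintro n ⟨m, hm⟩
    have hm : m.1 b = n.1 c := hm
    have e : (n⁻¹ * m : N).1 b = c := by simp [hm]
    exact hbc ((h.eq_of_inc_of_inc (n := n⁻¹ * m) hb (by rwa [e])).symm.trans e)
  have hcb := (D.mem_of_inc hc).2
  have hbb := (D.mem_of_inc hb).2
  have hnc : n.1 c ∈ D.blocks := (h.blocks_iff (h.le n.2) c).2 hcb
  have h1 := (hμ b hbb c hcb hbc).1 (by simpa using horb 1)
  have h2 := (hμ b hbb (n.1 c) hnc (fun e => horb n (e ▸ MulAction.mem_orbit_self b))).1 (horb n)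
  rw [← h1] at h2
  have h3 : {x | D.Inc x b ∧ D.Inc x (n.1 c)}.Nonempty := by
    rw [← Set.encard_ne_zero, h2, Set.encard_ne_zero]
    exact ⟨x₀, hb, hc⟩
  obtain ⟨y, hyb, hyc⟩ := h3
  obtain ⟨k, rfl⟩ := h.exists_eq (D.mem_of_inc hyb).1
  have hk := (h.inc_apply_iff hb k 1).1 (by simpa using hyb)
  have hl := (h.inc_apply_iff hc k n).1 hyc
  exact ⟨k, by simpa using hk, (n⁻¹ * k)⁻¹, inv_mem hl, by group⟩

theorem blockGroup_ne_top {b : V} (hb : D.Inc x₀ b) : blockGroup N b ≠ ⊤ := by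
  intro htop
  obtain ⟨x, hx, hxb⟩ := h.exists_not_inc (D.mem_of_inc hb).2
  obtain ⟨n, rfl⟩ := h.exists_eq hx
  refine hxb ?_
  have := (h.inc_apply_iff hb n 1).2 (by rw [htop]; trivial)
  simpa using this

theorem eq_of_blockGroup_eq {b c : V} (hb : D.Inc x₀ b) (hc : D.Inc x₀ c)
    (e : blockGroup N b = blockGroup N c) : b = c := by
  by_contra hbc
  refine h.blockGroup_ne_top hb ((Subgroup.eq_top_iff' _).2 fun n => ?_)
  obtain ⟨k, hk, l, hl, rfl⟩ := h.exists_mul_eq hb hc hbc n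
  exact mul_mem hk (e ▸ hl)

/-- There are no repeated blocks: moved to pass through `x₀`, blocks with the same points have the
same stabiliser, and two distinct ones would give `N = N_b N_b`. -/
theorem eq_of_inc_iff {b c : V} (hb : b ∈ D.blocks) (hbc : ∀ x, D.Inc x b ↔ D.Inc x c) :
    b = c := by
  obtain ⟨n, hn⟩ := h.exists_inc_apply hb
  have key : ∀ x, D.Inc x (n.1 b) ↔ D.Inc x (n.1 c) := by
    intro x
    obtain ⟨y, rfl⟩ := n.1.surjective x
    rw [h.inc_iff', h.inc_iff', hbc]
  have hn' := (key _).1 hn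
  refine n.1.injective (h.eq_of_blockGroup_eq hn hn' (Subgroup.ext fun k => ?_))
  have h1 := h.inc_apply_iff hn k 1
  have h2 := h.inc_apply_iff hn' k 1
  simp only [inv_one, one_mul, OneMemClass.coe_one, Equiv.Perm.one_apply] at h1 h2
  rw [← h1, ← h2, key]

/-- The blocks through `x₀` represent the `N`-orbits of blocks, once each. -/
theorem exists_equiv_fin : Nonempty (Fin r ≃ {b : V // D.Inc x₀ b}) := by
  have himg : (fun b => MulAction.orbit N b) '' {b | D.Inc x₀ b} = orbitsIn N D.blocks := by
    ext O
    constructor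
    · rintro ⟨b, hb, rfl⟩
      exact ⟨b, (D.mem_of_inc hb).2, rfl⟩
    · rintro ⟨b, hb, rfl⟩
      obtain ⟨n, hn⟩ := h.exists_inc_apply hb
      exact ⟨n.1 b, hn, MulAction.orbit_eq_iff.2 ⟨n, rfl⟩⟩
  have hinj : Set.InjOn (fun b => MulAction.orbit N b) {b | D.Inc x₀ b} := by
    intro b hb c hc e
    obtain ⟨n, hn⟩ := MulAction.orbit_eq_iff.1 e
    have hn : n.1 c = b := hn
    exact hn.symm.trans (h.eq_of_inc_of_inc (n := n) hc (by rwa [hn]))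
  have hcard : {b | D.Inc x₀ b}.encard = r := by
    rw [← hinj.encard_image, himg, h.orbits]
  have hfin := Set.finite_of_encard_eq_coe hcard
  have : Finite {b : V // D.Inc x₀ b} := hfin
  refine ⟨(Finite.equivFinOfCardEq ?_).symm⟩
  have : {b | D.Inc x₀ b}.ncard = r := by simp [Set.ncard, hcard]
  exact this

end RegularNicelyAffine

/-! ### Pairwise transitivity as fusion under conjugation -/

/-- The conjugation action of `G` on `N`. -/
def RegularNicelyAffine.conj {V : Type*} {D : Design V} {G N : Subgroup (Equiv.Perm V)} {r : ℕ}
    {x₀ : V} (h : RegularNicelyAffine D G N r x₀) : G →* MulAut N :=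
  N.normalizerMonoidHom.comp (Subgroup.inclusion h.le_normalizer)

namespace RegularNicelyAffine

variable {V : Type*} {D : Design V} {G N : Subgroup (Equiv.Perm V)} {r : ℕ} {x₀ : V}
  (h : RegularNicelyAffine D G N r x₀)

include h

theorem coe_conj (g : G) (n : N) : (h.conj g n).1 = g.1 * n.1 * g.1⁻¹ := rfl

theorem conj_apply_apply (g : G) (n : N) (x : V) : (h.conj g n).1 (g.1 x) = g.1 (n.1 x) := by
  simp [coe_conj]

theorem conj_mem_blockGroup_iff (g : G) (n : N) (b : V) :
    h.conj g n ∈ blockGroup N (g.1 b) ↔ n ∈ blockGroup N b := by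
  rw [mem_blockGroup, mem_blockGroup, conj_apply_apply]
  exact g.1.injective.eq_iff

theorem collinear_of_mem {b : V} (hb : D.Inc x₀ b) {n : N} (hn : n ∈ blockGroup N b) (hn1 : n ≠ 1) :
    D.Collinear x₀ (n.1 x₀) := by
  refine ⟨h.base_mem, h.mem_points n, fun e => hn1 ?_, b, hb, ?_⟩
  · exact h.eq_of_apply_eq (by simpa using e.symm)
  · simpa using (h.inc_apply_iff hb n 1).2 (by simpa using hn)

theorem nonCollinear_of_not_mem {n : N} (hn : ∀ b, D.Inc x₀ b → n ∉ blockGroup N b) (hn1 : n ≠ 1) :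
    D.NonCollinear x₀ (n.1 x₀) := by
  refine ⟨h.base_mem, h.mem_points n, fun e => hn1 ?_, ?_⟩
  · exact h.eq_of_apply_eq (by simpa using e.symm)
  · rintro ⟨b, hb, hnb⟩
    exact hn b hb (by simpa using (h.inc_apply_iff hb n 1).1 (by simpa using hnb))

/-- For `g` fixing `x₀`, the identification of `N` with the points turns conjugation into the action
on points. -/
theorem conj_eq_of_apply {g : G} (hg : g.1 x₀ = x₀) {m n : N} (e : g.1 (m.1 x₀) = n.1 x₀) :
    h.conj g m = n := by
  refine h.eq_of_apply_eq ?_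
  rw [← e, ← h.conj_apply_apply, hg]

theorem exists_conj_eq {b c : V} (hb : D.Inc x₀ b) (hc : D.Inc x₀ c) {m n : N}
    (hm : m ∈ blockGroup N b) (hn : n ∈ blockGroup N c) (hm1 : m ≠ 1) (hn1 : n ≠ 1) :
    ∃ g : G, h.conj g m = n := by
  obtain ⟨g, hg, e1, e2⟩ := h.pairwise.2.2.2.1 _ _ _ _ (h.collinear_of_mem hb hm hm1)
    (h.collinear_of_mem hc hn hn1)
  exact ⟨⟨g, hg⟩, h.conj_eq_of_apply (g := ⟨g, hg⟩) e1 e2⟩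

theorem exists_conj_eq_of_not_mem {m n : N} (hm : ∀ b, D.Inc x₀ b → m ∉ blockGroup N b)
    (hn : ∀ b, D.Inc x₀ b → n ∉ blockGroup N b) (hm1 : m ≠ 1) (hn1 : n ≠ 1) :
    ∃ g : G, h.conj g m = n := by
  obtain ⟨g, hg, e1, e2⟩ := h.pairwise.2.2.2.2.1 _ _ _ _ (h.nonCollinear_of_not_mem hm hm1)
    (h.nonCollinear_of_not_mem hn hn1)
  exact ⟨⟨g, hg⟩, h.conj_eq_of_apply (g := ⟨g, hg⟩) e1 e2⟩

theorem exists_apply_eq_apply_eq {b c b' c' : V} (hb : D.Inc x₀ b) (hc : D.Inc x₀ c)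
    (hb' : D.Inc x₀ b') (hc' : D.Inc x₀ c') (hbc : b ≠ c) (hbc' : b' ≠ c') :
    ∃ g : G, g.1 b = b' ∧ g.1 c = c' := by
  obtain ⟨g, hg, e1, e2⟩ := h.pairwise.2.2.2.2.2.1 b c b' c'
    ⟨(D.mem_of_inc hb).2, (D.mem_of_inc hc).2, hbc, x₀, hb, hc⟩
    ⟨(D.mem_of_inc hb').2, (D.mem_of_inc hc').2, hbc', x₀, hb', hc'⟩
  exact ⟨⟨g, hg⟩, e1, e2⟩

/-- For `n ∉ N_b`, the blocks `b` and `n b` are disjoint. The element `g` fixes `b` but may move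
`x₀`. -/
theorem exists_conj_mem_coset {b : V} (hb : D.Inc x₀ b) {m n : N} (hm : m ∉ blockGroup N b)
    (hn : n ∉ blockGroup N b) : ∃ g : G, g.1 b = b ∧ n⁻¹ * h.conj g m ∈ blockGroup N b := by
  have key : ∀ n : N, n ∉ blockGroup N b → D.NonIntersecting b (n.1 b) := by
    intro n hn
    refine ⟨(D.mem_of_inc hb).2, (h.blocks_iff (h.le n.2) b).2 (D.mem_of_inc hb).2,
      fun e => hn (mem_blockGroup.2 e.symm), ?_⟩
    rintro ⟨x, hx, hx'⟩
    exact hn (h.eq_of_inc_of_inc hx hx')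
  obtain ⟨g, hg, e1, e2⟩ := h.pairwise.2.2.2.2.2.2 _ _ _ _ (key m hm) (key n hn)
  refine ⟨⟨g, hg⟩, e1, ?_⟩
  have := h.conj_apply_apply ⟨g, hg⟩ m b
  simp only [e1, e2] at this
  rw [mem_blockGroup]
  simp [this]

theorem exists_inc_ne : ∃ b c, D.Inc x₀ b ∧ D.Inc x₀ c ∧ b ≠ c := by
  obtain ⟨e⟩ := h.exists_equiv_fin
  have := h.three_le
  refine ⟨_, _, (e ⟨0, by omega⟩).2, (e ⟨1, by omega⟩).2, fun hh => ?_⟩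
  have := e.injective (Subtype.ext hh)
  simp at this

theorem exists_isElementaryAbelian [Finite V] (hN : N ≠ ⊥) : ∃ p, IsElementaryAbelian p N := by
  have : Nontrivial N := (Subgroup.nontrivial_iff_ne_bot N).2 hN
  obtain ⟨b, c, hb, hc, hbc⟩ := h.exists_inc_ne
  refine Starlike.exists_isElementaryAbelian (H := blockGroup N b) (K := blockGroup N c)
    h.conj.range (h.exists_mul_eq hc hb hbc.symm) ?_ ?_
  · have key : ∀ u : N, u ∈ blockGroup N b ∨ u ∈ blockGroup N c →
        ∃ d, D.Inc x₀ d ∧ u ∈ blockGroup N d := by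
      rintro u (hu | hu)
      exacts [⟨b, hb, hu⟩, ⟨c, hc, hu⟩]
    intro u v hu hv hu1 hv1
    obtain ⟨d, hd, hud⟩ := key u hu
    obtain ⟨d', hd', hvd⟩ := key v hv
    obtain ⟨g, hg⟩ := h.exists_conj_eq hd hd' hud hvd hu1 hv1
    exact ⟨_, ⟨g, rfl⟩, hg⟩
  · intro u v hu hv
    obtain ⟨g, -, hg⟩ := h.exists_conj_mem_coset hb hu hv
    exact ⟨_, ⟨g, rfl⟩, hg⟩

theorem exists_blockGroup_eq (hc : ∀ m n : N, m * n = n * m) {b : V} (hb : b ∈ D.blocks) :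
    ∃ c, D.Inc x₀ c ∧ blockGroup N c = blockGroup N b := by
  obtain ⟨n, hn⟩ := h.exists_inc_apply hb
  refine ⟨_, hn, Subgroup.ext fun k => ?_⟩
  rw [mem_blockGroup, mem_blockGroup]
  have : k.1 (n.1 b) = n.1 (k.1 b) := congrArg (fun m : N => m.1 b) (hc k n)
  rw [this]
  exact n.1.injective.eq_iff

theorem conj_eq_one (hc : ∀ m n : N, m * n = n * m) (n : N) : h.conj ⟨n.1, h.le n.2⟩ = 1 := by
  ext1 m
  have : h.conj ⟨n.1, h.le n.2⟩ m = n * m * n⁻¹ := rfl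
  rw [this, hc n m]
  simp

end RegularNicelyAffine

end Starlike

namespace Starlike

/-! ### The linear model and its affine data -/

namespace RegularNicelyAffine

variable {V : Type*} {D : Design V} {G N : Subgroup (Equiv.Perm V)} {r : ℕ} {x₀ : V} {p d : ℕ}

/-- The conjugation action of `G` on the vector space identified with `N`. -/
def linearRep (h : RegularNicelyAffine D G N r x₀) (φ : Additive N ≃+ (Fin d → ZMod p)) :
    G →* ((Fin d → ZMod p) ≃ₗ[ZMod p] (Fin d → ZMod p)) :=
  (linearOfMulAut φ).comp h.conj

/-- The stabiliser of a block in `N`, as a subspace of the vector space identified with `N`. -/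
def blockSubmodule (φ : Additive N ≃+ (Fin d → ZMod p)) (b : V) :
    Submodule (ZMod p) (Fin d → ZMod p) :=
  AddSubgroup.toZModSubmodule p ((Subgroup.toAddSubgroup (blockGroup N b)).comap φ.symm.toAddMonoidHom)

theorem mem_blockSubmodule {φ : Additive N ≃+ (Fin d → ZMod p)} {b : V} {n : N} :
    φ (.ofMul n) ∈ blockSubmodule φ b ↔ n ∈ blockGroup N b := by
  change (φ.symm (φ (.ofMul n))).toMul ∈ blockGroup N b ↔ _
  simp

theorem exists_ofMul_eq (φ : Additive N ≃+ (Fin d → ZMod p)) (w : Fin d → ZMod p) :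
    ∃ n : N, φ (.ofMul n) = w :=
  ⟨(φ.symm w).toMul, by simp⟩

theorem ofMul_eq_zero {φ : Additive N ≃+ (Fin d → ZMod p)} {n : N} :
    φ (.ofMul n) = 0 ↔ n = 1 := by
  simp

variable (h : RegularNicelyAffine D G N r x₀) (φ : Additive N ≃+ (Fin d → ZMod p))

theorem linearRep_apply (g : G) (n : N) :
    h.linearRep φ g (φ (.ofMul n)) = φ (.ofMul (h.conj g n)) :=
  linearOfMulAut_apply φ _ n

include φ in
theorem mul_comm_of_addEquiv (m n : N) : m * n = n * m := by
  have : φ (.ofMul (m * n)) = φ (.ofMul (n * m)) := by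
    rw [ofMul_mul, ofMul_mul, map_add, map_add, add_comm]
  exact Additive.ofMul.injective (φ.injective this)

theorem map_blockSubmodule (g : G) (b : V) :
    (blockSubmodule φ b).map (h.linearRep φ g).toLinearMap = blockSubmodule φ (g.1 b) := by
  ext w
  rw [Submodule.mem_map_equiv]
  obtain ⟨n, rfl⟩ := exists_ofMul_eq φ w
  have e : (h.linearRep φ g).symm (φ (.ofMul n)) = φ (.ofMul (h.conj g⁻¹ n)) := by
    rw [LinearEquiv.symm_apply_eq, linearRep_apply, ← MulAut.mul_apply, ← map_mul]
    simp
  rw [e, mem_blockSubmodule, mem_blockSubmodule, ← h.conj_mem_blockGroup_iff g, ← MulAut.mul_apply,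
    ← map_mul]
  simp

variable (e : Fin r ≃ {b : V // D.Inc x₀ b})

include h in
theorem exists_blockSubmodule_eq {b : V} (hb : b ∈ D.blocks) :
    ∃ i, blockSubmodule φ (e i).1 = blockSubmodule φ b := by
  obtain ⟨c, hc, hcb⟩ := h.exists_blockGroup_eq (mul_comm_of_addEquiv φ) hb
  refine ⟨e.symm ⟨c, hc⟩, ?_⟩
  simp only [Equiv.apply_symm_apply, blockSubmodule, hcb]

theorem exists_linearRep_map (i j k l : Fin r) (hij : i ≠ j) (hkl : k ≠ l) :
    ∃ g : G, (blockSubmodule φ (e i).1).map (h.linearRep φ g).toLinearMap =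
        blockSubmodule φ (e k).1 ∧
      (blockSubmodule φ (e j).1).map (h.linearRep φ g).toLinearMap = blockSubmodule φ (e l).1 := by
  have hne : ∀ {i j}, i ≠ j → (e i).1 ≠ (e j).1 := fun hij hh => hij (e.injective (Subtype.ext hh))
  obtain ⟨g, h1, h2⟩ := h.exists_apply_eq_apply_eq (e i).2 (e j).2 (e k).2 (e l).2 (hne hij) (hne hkl)
  exact ⟨g, by rw [map_blockSubmodule, h1], by rw [map_blockSubmodule, h2]⟩

theorem exists_linearRep_eq {i j : Fin r} {u v : Fin d → ZMod p} (hu0 : u ≠ 0) (hv0 : v ≠ 0)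
    (hu : u ∈ blockSubmodule φ (e i).1) (hv : v ∈ blockSubmodule φ (e j).1) :
    ∃ g : G, h.linearRep φ g u = v := by
  obtain ⟨m, rfl⟩ := exists_ofMul_eq φ u
  obtain ⟨n, rfl⟩ := exists_ofMul_eq φ v
  obtain ⟨g, hg⟩ := h.exists_conj_eq (e i).2 (e j).2 (mem_blockSubmodule.1 hu)
    (mem_blockSubmodule.1 hv) (mt ofMul_eq_zero.2 hu0) (mt ofMul_eq_zero.2 hv0)
  exact ⟨g, by rw [linearRep_apply, hg]⟩

theorem exists_linearRep_eq_of_not_mem {u v : Fin d → ZMod p} (hu0 : u ≠ 0) (hv0 : v ≠ 0)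
    (hu : ∀ i, u ∉ blockSubmodule φ (e i).1) (hv : ∀ i, v ∉ blockSubmodule φ (e i).1) :
    ∃ g : G, h.linearRep φ g u = v := by
  obtain ⟨m, rfl⟩ := exists_ofMul_eq φ u
  obtain ⟨n, rfl⟩ := exists_ofMul_eq φ v
  have key : ∀ n : N, (∀ i, φ (.ofMul n) ∉ blockSubmodule φ (e i).1) →
      ∀ b, D.Inc x₀ b → n ∉ blockGroup N b := by
    intro n hn b hb hnb
    refine hn (e.symm ⟨b, hb⟩) (mem_blockSubmodule.2 ?_)
    simpa using hnb
  obtain ⟨g, hg⟩ := h.exists_conj_eq_of_not_mem (key m hu) (key n hv) (mt ofMul_eq_zero.2 hu0)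
    (mt ofMul_eq_zero.2 hv0)
  exact ⟨g, by rw [linearRep_apply, hg]⟩

theorem exists_linearRep_mem_iUnion (g : G) {i : Fin r} {u : Fin d → ZMod p}
    (hu : u ∈ blockSubmodule φ (e i).1) : ∃ j, h.linearRep φ g u ∈ blockSubmodule φ (e j).1 := by
  obtain ⟨j, hj⟩ := h.exists_blockSubmodule_eq φ e
    (b := g.1 (e i).1) ((h.blocks_iff g.2 _).2 (D.mem_of_inc (e i).2).2)
  refine ⟨j, ?_⟩
  rw [hj, ← map_blockSubmodule]
  exact Submodule.mem_map_of_mem hu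

include h in
theorem sup_blockSubmodule_eq_top {i j : Fin r} (hij : i ≠ j) :
    blockSubmodule φ (e i).1 ⊔ blockSubmodule φ (e j).1 = ⊤ := by
  refine Submodule.eq_top_iff'.2 fun w => ?_
  obtain ⟨n, rfl⟩ := exists_ofMul_eq φ w
  obtain ⟨k, hk, l, hl, rfl⟩ := h.exists_mul_eq (e i).2 (e j).2
    (fun hh => hij (e.injective (Subtype.ext hh))) n
  rw [ofMul_mul, map_add]
  exact Submodule.add_mem_sup (mem_blockSubmodule.2 hk) (mem_blockSubmodule.2 hl)

include h in
-- If all these subspaces were zero, two of them spanning `V` would make `N` trivial, hence equal to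
-- a block stabiliser.
theorem exists_mem_blockSubmodule_ne_zero : ∃ i, ∃ u ∈ blockSubmodule φ (e i).1, u ≠ 0 := by
  by_contra! hcon
  have hr := h.three_le
  have hij : (⟨0, by omega⟩ : Fin r) ≠ ⟨1, by omega⟩ := by simp
  have htop := h.sup_blockSubmodule_eq_top φ e hij
  have hbot : ∀ i, blockSubmodule φ (e i).1 = ⊥ := fun i => (Submodule.eq_bot_iff _).2 (hcon i)
  rw [hbot, hbot, bot_sup_eq] at htop
  refine h.blockGroup_ne_top (e ⟨0, by omega⟩).2 ((Subgroup.eq_top_iff' _).2 fun n => ?_)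
  rw [← mem_blockSubmodule (φ := φ), hbot, htop]
  trivial

/-- The affine data determined by a regular nicely affine design. -/
def affineData (hp : p.Prime) : AffineData p d r where
  prime := hp
  three_le := h.three_le
  -- Taking the image of all of `G`, not just of the stabiliser of `x₀`, admits fusing elements that
  -- move `x₀`. Nothing is added, since the abelian group `N` acts trivially.
  G₀ := (h.linearRep φ).range
  M i := blockSubmodule φ (e i).1
  M_injective i j hij := by
    have hij : blockSubmodule φ (e i).1 = blockSubmodule φ (e j).1 := hij
    refine e.injective (Subtype.ext (h.eq_of_blockGroup_eq (e i).2 (e j).2 (Subgroup.ext fun n => ?_)))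
    rw [← mem_blockSubmodule (φ := φ), hij, mem_blockSubmodule]
  rank := by
    obtain ⟨i, u, hu, hu0⟩ := h.exists_mem_blockSubmodule_ne_zero φ e
    refine hasRank_affineGroup _ {v | v ≠ 0 ∧ ∃ i, v ∈ blockSubmodule φ (e i).1} (fun hh => hh.1 rfl)
      ⟨u, hu0, i, hu⟩ ?_ ?_ ?_
    · rintro _ ⟨g, rfl⟩ v ⟨hv, j, hj⟩
      exact ⟨by simpa using hv, h.exists_linearRep_mem_iUnion φ e g hj⟩
    · rintro u ⟨hu, i, hi⟩ v ⟨hv, j, hj⟩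
      obtain ⟨g, hg⟩ := h.exists_linearRep_eq φ e hu hv hi hj
      exact ⟨_, ⟨g, rfl⟩, hg⟩
    · intro u v hu hv hu' hv'
      obtain ⟨g, hg⟩ := h.exists_linearRep_eq_of_not_mem φ e hu hv (fun i hi => hu' ⟨hu, i, hi⟩)
        (fun i hi => hv' ⟨hv, i, hi⟩)
      exact ⟨_, ⟨g, rfl⟩, hg⟩
  isOrbit := by
    have hr := h.three_le
    refine ⟨blockSubmodule φ (e ⟨0, by omega⟩).1, Set.ext fun U => ⟨?_, ?_⟩⟩
    · rintro ⟨i, rfl⟩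
      have : Nontrivial (Fin r) := Fin.nontrivial_iff_two_le.2 (by omega)
      -- The auxiliary `j` and `k` complete single indices to pairs, so that 2-transitivity gives
      -- transitivity.
      obtain ⟨j, hj⟩ := exists_ne (⟨0, by omega⟩ : Fin r)
      obtain ⟨k, hk⟩ := exists_ne i
      obtain ⟨g, hg, -⟩ := h.exists_linearRep_map φ e _ j i k hj.symm hk.symm
      exact ⟨_, ⟨g, rfl⟩, hg.symm⟩
    · rintro ⟨_, ⟨g, rfl⟩, rfl⟩
      rw [map_blockSubmodule]
      exact h.exists_blockSubmodule_eq φ e ((h.blocks_iff g.2 _).2 (D.mem_of_inc (e _).2).2)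
  twoTransitive i j k l hij hkl := by
    obtain ⟨g, hg⟩ := h.exists_linearRep_map φ e i j k l hij hkl
    exact ⟨_, ⟨g, rfl⟩, hg⟩
  sup_eq_top _ _ hij := h.sup_blockSubmodule_eq_top φ e hij
  quotientTransitive i u v hu hv := by
    obtain ⟨m, rfl⟩ := exists_ofMul_eq φ u
    obtain ⟨n, rfl⟩ := exists_ofMul_eq φ v
    obtain ⟨g, hg, hgm⟩ := h.exists_conj_mem_coset (e i).2 (mt mem_blockSubmodule.2 hu)
      (mt mem_blockSubmodule.2 hv)
    refine ⟨_, ⟨g, rfl⟩, by rw [map_blockSubmodule, hg], ?_⟩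
    rw [Submodule.mkQ_apply, Submodule.mkQ_apply, Submodule.Quotient.eq, linearRep_apply, ← map_sub,
      ← ofMul_div, mem_blockSubmodule, div_eq_mul_inv, mul_comm_of_addEquiv φ]
    exact hgm
  unionOrbit := by
    obtain ⟨i, u, hu, hu0⟩ := h.exists_mem_blockSubmodule_ne_zero φ e
    refine ⟨u, Set.ext fun v => ⟨?_, ?_⟩⟩
    · rintro ⟨hv, j, hj⟩
      obtain ⟨g, hg⟩ := h.exists_linearRep_eq φ e hu0 hv hu hj
      exact ⟨_, ⟨g, rfl⟩, hg.symm⟩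
    · rintro ⟨_, ⟨g, rfl⟩, rfl⟩
      exact ⟨by simpa using hu0, h.exists_linearRep_mem_iUnion φ e g hu⟩

/-! ### The isomorphism with the coset design -/

/-- The set of vectors that correspond to the points on a block. -/
def pointVectors (D : Design V) (x₀ : V) (φ : Additive N ≃+ (Fin d → ZMod p)) (b : V) :
    Set (Fin d → ZMod p) :=
  {w | D.Inc ((φ.symm w).toMul.1 x₀) b}

theorem ofMul_mem_pointVectors {n : N} {b : V} :
    φ (.ofMul n) ∈ pointVectors D x₀ φ b ↔ D.Inc (n.1 x₀) b := by
  simp [pointVectors]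

include h in
theorem pointVectors_apply {b : V} (hb : D.Inc x₀ b) (n : N) :
    pointVectors D x₀ φ (n.1 b) =
      φ (.ofMul n) +ᵥ (blockSubmodule φ b : Set (Fin d → ZMod p)) := by
  ext w
  obtain ⟨m, rfl⟩ := exists_ofMul_eq φ w
  rw [ofMul_mem_pointVectors, h.inc_apply_iff hb, Set.mem_vadd_set_iff_neg_vadd_mem, vadd_eq_add,
    ← map_neg, ← map_add, ← ofMul_inv, ← ofMul_mul, SetLike.mem_coe, mem_blockSubmodule]

theorem exists_pointVectors_eq (hp : p.Prime) {b : V} (hb : b ∈ D.blocks) :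
    ∃ (i : Fin r) (v : Fin d → ZMod p), pointVectors D x₀ φ b =
      v +ᵥ ((h.affineData φ e hp).M i : Set (Fin d → ZMod p)) := by
  obtain ⟨n, hn⟩ := h.exists_inc_apply hb
  -- The block `b` is the `n⁻¹`-translate of `n b`, which passes through `x₀`.
  refine ⟨e.symm ⟨_, hn⟩, φ (.ofMul n⁻¹), ?_⟩
  have := h.pointVectors_apply φ hn n⁻¹
  simp only [affineData, Equiv.apply_symm_apply]
  rw [← this]
  simp

open Classical in
/-- The identification of points with vectors and of blocks with cosets. -/
noncomputable def toAffine (hp : p.Prime) (x : V) :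
    (Fin d → ZMod p) ⊕ (h.affineData φ e hp).Block :=
  if hx : x ∈ D.points then .inl (φ (.ofMul (h.exists_eq hx).choose))
  else .inr ⟨pointVectors D x₀ φ x, h.exists_pointVectors_eq φ e hp
    ((D.isCompl.compl_eq ▸ hx : x ∈ D.blocks))⟩

variable (hp : p.Prime)

theorem toAffine_point (n : N) : h.toAffine φ e hp (n.1 x₀) = .inl (φ (.ofMul n)) := by
  have hx := h.mem_points n
  rw [toAffine, dif_pos hx, h.eq_of_apply_eq (h.exists_eq hx).choose_spec]

theorem toAffine_block {b : V} (hb : b ∈ D.blocks) :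
    h.toAffine φ e hp b = .inr ⟨pointVectors D x₀ φ b, h.exists_pointVectors_eq φ e hp hb⟩ := by
  rw [toAffine, dif_neg (fun hh => Set.disjoint_left.1 D.isCompl.disjoint hh hb)]

include h in
theorem point_or_block (x : V) : (∃ n : N, x = n.1 x₀) ∨ x ∈ D.blocks := by
  by_cases hx : x ∈ D.points
  · obtain ⟨n, hn⟩ := h.exists_eq hx
    exact .inl ⟨n, hn.symm⟩
  · exact .inr (D.isCompl.compl_eq ▸ hx)

theorem toAffine_bijective : Function.Bijective (h.toAffine φ e hp) := by
  constructor
  · intro x y hxy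
    rcases h.point_or_block x with ⟨m, rfl⟩ | hx <;> rcases h.point_or_block y with ⟨n, rfl⟩ | hy
    · rw [toAffine_point, toAffine_point] at hxy
      have hmn : m = n := by simpa using hxy
      rw [hmn]
    · rw [toAffine_point, toAffine_block _ _ _ _ hy] at hxy
      cases hxy
    · rw [toAffine_point, toAffine_block _ _ _ _ hx] at hxy
      cases hxy
    · rw [toAffine_block _ _ _ _ hx, toAffine_block _ _ _ _ hy] at hxy
      have hxy : pointVectors D x₀ φ x = pointVectors D x₀ φ y :=
        congrArg Subtype.val (Sum.inr_injective hxy)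
      refine h.eq_of_inc_iff hx fun z => ?_
      rcases h.point_or_block z with ⟨n, rfl⟩ | hz
      · rw [← ofMul_mem_pointVectors φ, hxy, ofMul_mem_pointVectors]
      · have : ∀ b, ¬ D.Inc z b := fun b hb =>
          Set.disjoint_left.1 D.isCompl.disjoint (D.mem_of_inc hb).1 hz
        simp [this]
  · rintro (w | ⟨S, i, v, rfl⟩)
    · obtain ⟨n, rfl⟩ := exists_ofMul_eq φ w
      exact ⟨_, h.toAffine_point φ e hp n⟩
    · obtain ⟨n, rfl⟩ := exists_ofMul_eq φ v
      refine ⟨n.1 (e i).1, ?_⟩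
      rw [toAffine_block _ _ _ _ ((h.blocks_iff (h.le n.2) _).2 (D.mem_of_inc (e i).2).2)]
      exact congrArg Sum.inr (Subtype.ext (h.pointVectors_apply φ (e i).2 n))

/-- The identification of points with vectors and of blocks with cosets, as an equivalence. -/
noncomputable def equivAffine : V ≃ (Fin d → ZMod p) ⊕ (h.affineData φ e hp).Block :=
  Equiv.ofBijective _ (h.toAffine_bijective φ e hp)

theorem equivAffine_point (n : N) : h.equivAffine φ e hp (n.1 x₀) = .inl (φ (.ofMul n)) :=
  h.toAffine_point φ e hp n

theorem equivAffine_block {b : V} (hb : b ∈ D.blocks) : h.equivAffine φ e hp b =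
    .inr ⟨pointVectors D x₀ φ b, h.exists_pointVectors_eq φ e hp hb⟩ :=
  h.toAffine_block φ e hp hb

theorem isIso_equivAffine : D.IsIso (h.affineData φ e hp).design (h.equivAffine φ e hp) := by
  have hdisj : ∀ {x}, x ∈ D.points → x ∈ D.blocks → False := fun hx hb =>
    Set.disjoint_left.1 D.isCompl.disjoint hx hb
  refine ⟨fun x => ?_, fun x => ?_, fun x b => ?_⟩
  · rcases h.point_or_block x with ⟨n, rfl⟩ | hx
    · rw [equivAffine_point]
      exact iff_of_true ⟨_, rfl⟩ (h.mem_points n)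
    · rw [equivAffine_block _ _ _ _ hx]
      exact iff_of_false (by rintro ⟨_, hh⟩; cases hh) (fun hh => hdisj hh hx)
  · rcases h.point_or_block x with ⟨n, rfl⟩ | hx
    · rw [equivAffine_point]
      exact iff_of_false (by rintro ⟨_, hh⟩; cases hh) (fun hh => hdisj (h.mem_points n) hh)
    · rw [equivAffine_block _ _ _ _ hx]
      exact iff_of_true ⟨_, rfl⟩ hx
  · constructor
    · rintro ⟨v, S, hx, hb, hv⟩
      rcases h.point_or_block x with ⟨n, rfl⟩ | hx'
      · rcases h.point_or_block b with ⟨m, rfl⟩ | hb'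
        · rw [equivAffine_point] at hb
          cases hb
        · rw [equivAffine_point] at hx
          rw [equivAffine_block _ _ _ _ hb'] at hb
          cases hx
          cases hb
          exact (ofMul_mem_pointVectors φ).1 hv
      · rw [equivAffine_block _ _ _ _ hx'] at hx
        cases hx
    · intro hxb
      obtain ⟨n, rfl⟩ := h.exists_eq (D.mem_of_inc hxb).1
      exact ⟨_, _, h.equivAffine_point φ e hp n, h.equivAffine_block φ e hp (D.mem_of_inc hxb).2,
        (ofMul_mem_pointVectors φ).2 hxb⟩

/-- The affine transformation induced by `g`, where `n` agrees with `g` at the base point. -/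
def toAffineGroup (g : G) (n : N) : affineGroup (h.affineData φ e hp).G₀ :=
  ⟨affineOfLinear (h.linearRep φ g) (φ (.ofMul n)), ⟨g, rfl⟩⟩

/-- From `g (m x₀) = (g m g⁻¹) n x₀`, the action on vectors is affine with linear part conjugation
by `g`. The action on blocks follows because a block is determined by its points. -/
theorem permCongr_eq_toPerm {g : G} {n : N} (hg : g.1 x₀ = n.1 x₀) :
    (h.equivAffine φ e hp).permCongrHom g.1 =
      MulAction.toPermHom (affineGroup (h.affineData φ e hp).G₀) _ (h.toAffineGroup φ e hp g n) := by
  have hpt : ∀ m : N, g.1 (m.1 x₀) = (h.conj g m * n : N).1 x₀ := by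
    intro m
    rw [← h.conj_apply_apply, hg]
    rfl
  have haff : ∀ m : N, (h.toAffineGroup φ e hp g n).1 (φ (.ofMul m)) =
      φ (.ofMul (h.conj g m * n)) := by
    intro m
    rw [toAffineGroup, affineOfLinear_apply, linearRep_apply, ofMul_mul, map_add]
  ext1 y
  obtain ⟨x, rfl⟩ := (h.equivAffine φ e hp).surjective y
  have e1 : (h.equivAffine φ e hp).permCongrHom g.1 (h.equivAffine φ e hp x) =
      h.equivAffine φ e hp (g.1 x) := by
    simp [Equiv.permCongrHom]
  rw [e1]
  rcases h.point_or_block x with ⟨m, rfl⟩ | hx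
  · rw [hpt, equivAffine_point, equivAffine_point, ← haff]
    rfl
  · rw [equivAffine_block _ _ _ _ hx, equivAffine_block _ _ _ _ ((h.blocks_iff g.2 x).2 hx)]
    refine congrArg Sum.inr (Subtype.ext (Set.ext fun w => ?_))
    change _ ↔ w ∈ (fun v => (h.toAffineGroup φ e hp g n).1 v) '' pointVectors D x₀ φ x
    constructor
    · obtain ⟨k, rfl⟩ := exists_ofMul_eq φ w
      intro hk
      obtain ⟨m, hm⟩ := h.exists_eq (x := g.1⁻¹ (k.1 x₀))
        ((h.points_iff (inv_mem g.2) _).2 (h.mem_points k))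
      have hkm : k = h.conj g m * n := h.eq_of_apply_eq (by rw [← hpt, hm]; simp)
      refine ⟨φ (.ofMul m), ?_, ?_⟩
      · rw [ofMul_mem_pointVectors] at hk ⊢
        rw [← h.inc_iff g.2, hm]
        simpa using hk
      · exact (haff m).trans (by rw [hkm])
    · rintro ⟨v, hv, rfl⟩
      obtain ⟨m, rfl⟩ := exists_ofMul_eq φ v
      have hv' := (h.inc_iff g.2 _ _).2 ((ofMul_mem_pointVectors φ).1 hv)
      change (h.toAffineGroup φ e hp g n).1 (φ (.ofMul m)) ∈ _
      rw [haff, ofMul_mem_pointVectors, ← hpt]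
      exact hv'

theorem linearRep_eq_one (n : N) : h.linearRep φ ⟨n.1, h.le n.2⟩ = 1 := by
  rw [linearRep, MonoidHom.comp_apply, h.conj_eq_one (mul_comm_of_addEquiv φ), map_one]

theorem map_group : G.map (h.equivAffine φ e hp).permCongrHom.toMonoidHom =
    (h.affineData φ e hp).group := by
  ext σ
  constructor
  · rintro ⟨g, hg, rfl⟩
    obtain ⟨n, hn⟩ := h.exists_eq ((h.points_iff hg x₀).2 h.base_mem)
    exact ⟨_, (h.permCongr_eq_toPerm φ e hp (g := ⟨g, hg⟩) hn.symm).symm⟩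
  · rintro ⟨⟨f, g, hg⟩, rfl⟩
    have hg : h.linearRep φ g = f.linear := hg
    obtain ⟨n, hn⟩ := h.exists_eq ((h.points_iff g.2 x₀).2 h.base_mem)
    obtain ⟨k, hk⟩ := exists_ofMul_eq φ (f 0)
    -- Multiplying `g` by `k n⁻¹ ∈ N` adjusts the image of `x₀` to match `f 0` without changing the
    -- linear part.
    have hkn : (⟨(k * n⁻¹ : N).1, h.le (k * n⁻¹ : N).2⟩ * g : G).1 x₀ = k.1 x₀ := by
      simp [← hn]
    refine ⟨_, (⟨(k * n⁻¹ : N).1, h.le (k * n⁻¹ : N).2⟩ * g : G).2, ?_⟩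
    refine (h.permCongr_eq_toPerm φ e hp hkn).trans ?_
    congr 1
    refine Subtype.ext ?_
    rw [toAffineGroup]
    simp only
    rw [map_mul, linearRep_eq_one, one_mul, hg, hk, ← eq_affineOfLinear]

theorem map_translationGroup : N.map (h.equivAffine φ e hp).permCongrHom.toMonoidHom =
    (h.affineData φ e hp).translationGroup := by
  have key : ∀ n : N, (h.toAffineGroup φ e hp ⟨n.1, h.le n.2⟩ n).1 =
      AffineEquiv.constVAddHom (ZMod p) (Fin d → ZMod p) (.ofAdd (φ (.ofMul n))) := by
    intro n
    change affineOfLinear (h.linearRep φ ⟨n.1, h.le n.2⟩) (φ (.ofMul n)) = _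
    rw [linearRep_eq_one]
    rfl
  ext σ
  constructor
  · rintro ⟨n, hn, rfl⟩
    exact ⟨_, ⟨_, (key ⟨n, hn⟩).symm⟩,
      (h.permCongr_eq_toPerm φ e hp (g := ⟨n, h.le hn⟩) (n := ⟨n, hn⟩) rfl).symm⟩
  · rintro ⟨f, ⟨w, hw⟩, rfl⟩
    obtain ⟨n, hn⟩ := exists_ofMul_eq φ w.toAdd
    refine ⟨n.1, n.2, (h.permCongr_eq_toPerm φ e hp (g := ⟨n.1, h.le n.2⟩) (n := n) rfl).trans ?_⟩
    congr 1
    refine Subtype.ext ?_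
    rw [key, hn]
    exact hw

end RegularNicelyAffine

/-! ### From the graph to its adjacency design -/

section Graph

variable {V : Type*} {Γ : SimpleGraph V} {B B' : Set V}

theorem IsOrderedBipartition.adj_iff (hB : IsOrderedBipartition Γ B B') (x y : V) :
    Γ.Adj x y ↔ (adjacencyDesign Γ B B' hB).Inc x y ∨ (adjacencyDesign Γ B B' hB).Inc y x := by
  constructor
  · intro hxy
    rcases hB.isBipartiteWith.mem_of_adj hxy with ⟨hx, hy⟩ | ⟨hx, hy⟩
    · exact .inl ⟨hx, hy, hxy⟩
    · exact .inr ⟨hy, hx, hxy.symm⟩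
  · rintro (hxy | hxy)
    · exact hxy.2.2
    · exact hxy.2.2.symm

theorem incidenceGraph_adj_iff_of_isIso (hB : IsOrderedBipartition Γ B B') {W : Type*} {E : Design W}
    {Φ : V ≃ W} (hΦ : (adjacencyDesign Γ B B' hB).IsIso E Φ) (x y : V) :
    E.incidenceGraph.Adj (Φ x) (Φ y) ↔ Γ.Adj x y := by
  rw [hB.adj_iff, ← hΦ.2.2, ← hΦ.2.2]
  rfl

theorem IsOrderedBipartition.exists_inc (hB : IsOrderedBipartition Γ B B') (hconn : Γ.Connected)
    (hne : B.Nonempty) {b : V} (hb : b ∈ B') : ∃ x, (adjacencyDesign Γ B B' hB).Inc x b := by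
  obtain ⟨y, hy⟩ := hne
  have : Nontrivial V :=
    ⟨y, b, fun hh => Set.disjoint_left.1 hB.isCompl.disjoint hy (hh ▸ hb)⟩
  obtain ⟨x, hx⟩ := hconn.preconnected.exists_adj_of_nontrivial b
  rcases (hB.adj_iff b x).1 hx with hx | hx
  · exact (Set.disjoint_left.1 hB.isCompl.disjoint hx.1 hb).elim
  · exact ⟨x, hx⟩

/-- A complete bipartite graph has diameter at most `2`. -/
theorem IsOrderedBipartition.exists_nonIncident (hB : IsOrderedBipartition Γ B B')
    (hne : B.Nonempty) (hne' : B'.Nonempty) (hdiam : 2 < Γ.ediam) :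
    ∃ x b, (adjacencyDesign Γ B B' hB).NonIncident x b := by
  by_contra! hcon
  have hadj : ∀ x ∈ B, ∀ b ∈ B', Γ.Adj x b := by
    intro x hx b hb
    by_contra hxb
    exact hcon x b ⟨hx, hb, fun hh => hxb hh.2.2⟩
  obtain ⟨x₀, hx₀⟩ := hne
  obtain ⟨b₀, hb₀⟩ := hne'
  have hwalk : ∀ {u v w}, Γ.Adj u w → Γ.Adj w v → Γ.edist u v ≤ 2 := fun h1 h2 =>
    SimpleGraph.edist_le (.cons h1 (.cons h2 .nil))
  have hone : ∀ {u v}, Γ.Adj u v → Γ.edist u v ≤ 2 := fun h1 =>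
    (SimpleGraph.edist_le (.cons h1 .nil)).trans (by simp)
  refine hdiam.not_ge (SimpleGraph.ediam_le_of_edist_le fun u v => ?_)
  have hmem : ∀ u, u ∈ B ∨ u ∈ B' := fun u => by
    exact (show B ∪ B' = Set.univ from hB.isCompl.sup_eq_top).ge (Set.mem_univ u)
  rcases hmem u with hu | hu <;> rcases hmem v with hv | hv
  · exact hwalk (hadj u hu b₀ hb₀) (hadj v hv b₀ hb₀).symm
  · exact hone (hadj u hu v hv)
  · exact hone (hadj v hv u hu).symm
  · exact hwalk (hadj x₀ hx₀ u hu).symm (hadj x₀ hx₀ v hv)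

end Graph

end Starlike

theorem mainTheorem2 {V : Type*} [Finite V] (Γ : SimpleGraph V) (B B' : Set V)
    (hB : Starlike.IsOrderedBipartition Γ B B') (hconn : Γ.Connected)
    (G N : Subgroup (Equiv.Perm V)) (hG : Starlike.ActsOnGraph Γ G)
    (hN1 : N ≠ ⊥) (hNG : Starlike.IsNormalSubgroupOf N G) (r : ℕ) (hr : 3 ≤ r)
    -- condition (a)
    (ha : Starlike.IsStarlike Γ B B' N r ∧ Starlike.LocallyDistanceTransitive Γ G 4)
    -- condition (b)
    (hb : (Starlike.adjacencyDesign Γ B B' hB).PairwiseTransitive G ∧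
      (Starlike.adjacencyDesign Γ B B' hB).NicelyAffine N ∧
      (Starlike.orbitsIn N B').encard = r)
    (hreg : Starlike.RegularOn N B) :
    ∃ p : ℕ, Starlike.IsElementaryAbelian p N ∧
      ∃ (d : ℕ) (C : Starlike.AffineData p d r) (Φ : V ≃ (Fin d → ZMod p) ⊕ C.Block),
        (Starlike.adjacencyDesign Γ B B' hB).IsIso C.design Φ ∧
        (∀ x y, C.design.incidenceGraph.Adj (Φ x) (Φ y) ↔ Γ.Adj x y) ∧
        G.map Φ.permCongrHom.toMonoidHom = C.group ∧
        N.map Φ.permCongrHom.toMonoidHom = C.translationGroup := by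
  have hne' : B'.Nonempty := by
    by_contra hcon
    rw [Set.not_nonempty_iff_eq_empty] at hcon
    have h0 := hb.2.2
    have he : Starlike.orbitsIn N B' = ∅ := by simp [Starlike.orbitsIn, hcon]
    rw [he, Set.encard_empty] at h0
    have : r = 0 := by exact_mod_cast h0.symm
    omega
  obtain ⟨b₀, hb₀⟩ := hne'
  -- This rules out both a one-vertex graph and a complete bipartite one; the latter supplies the
  -- non-incident pair.
  have hdiam : (2 : ℕ∞) < Γ.ediam := lt_of_lt_of_le (by norm_num) ha.2.1
  have hne : B.Nonempty := by
    have : Nontrivial V := SimpleGraph.nontrivial_of_ediam_ne_zero (ne_bot_of_gt hdiam)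
    obtain ⟨x, hx⟩ := hconn.preconnected.exists_adj_of_nontrivial b₀
    rcases hB.isBipartiteWith.mem_of_adj hx with h | h
    exacts [⟨_, h.1⟩, ⟨_, h.2⟩]
  obtain ⟨x₀, hx₀⟩ := hne
  have h : Starlike.RegularNicelyAffine (Starlike.adjacencyDesign Γ B B' hB) G N r x₀ :=
    { le := hNG.1
      le_normalizer := (Subgroup.normal_subgroupOf_iff_le_normalizer hNG.1).1 hNG.2
      three_le := hr
      base_mem := hx₀
      regular := hreg
      pairwise := hb.1
      affine := hb.2.1
      orbits := hb.2.2
      exists_inc := fun b hb => hB.exists_inc hconn ⟨x₀, hx₀⟩ hb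
      exists_nonIncident := hB.exists_nonIncident ⟨x₀, hx₀⟩ ⟨b₀, hb₀⟩ hdiam }
  obtain ⟨p, hp⟩ := h.exists_isElementaryAbelian hN1
  obtain ⟨d, ⟨φ⟩⟩ := Starlike.exists_addEquiv_fin_zmod hp
  obtain ⟨e⟩ := h.exists_equiv_fin
  have hiso := h.isIso_equivAffine φ e hp.1
  exact ⟨p, hp, d, h.affineData φ e hp.1, h.equivAffine φ e hp.1, hiso,
    Starlike.incidenceGraph_adj_iff_of_isIso hB hiso, h.map_group φ e hp.1,
    h.map_translationGroup φ e hp.1⟩
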